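/- Let $(R,\mathfrak m,k)$ be a commutative Noetherian local ring and let $M$ be a non-zero $R$-module. Assume that $M$ is $\operatorname{Ext}$-finite, i.e. $\operatorname{Ext}^i_R(N,M)$ is a finitely generated $R$-module for every finitely generated $R$-module $N$ and every $i\ge 1$. A quasi-injective resolution of $M$ is a bounded above complex $I=(\cdots\to I_{i+1}\to I_i\to I_{i-1}\to\cdots)$ of injective $R$-modules such that $H_i(I)\cong M^{\oplus b_i}$ for all $i$, where the $b_i$ are non-negative integers, not all zero. The quasi-injective dimension of $M\neq 0$ is $$\operatorname{qid}_R M=\inf\{\operatorname{hinf} I-\inf I : I \text{ is a bounded quasi-injective resolution of } M\},$$ where $\inf I=\inf\{i: I_i\ne 0\}$ and $\operatorname{hinf} I=\inf\{i: H_i(I)\neq 0\}$, and $\inf\emptyset=\infty$. Assume that $\operatorname{qid}_R M<\infty$. Then for every maximal $R$-sequence $\boldsymbol{x}$ in $\mathfrak m$ (that is, every $R$-regular sequence of elements of $\mathfrak m$, possibly empty, that cannot be extended by an element of $\mathfrak m$ to a longer $R$-regular sequence) the following hold. 1. $\operatorname{qid}_R M=0$ if and only if $\operatorname{Ext}^i_R(R/(\boldsymbol{x}),M)=0$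 for all $i>0$. 2. If $\operatorname{qid}_R M\neq 0$, then $\operatorname{qid}_R M=\sup\{i : \operatorname{Ext}^i_R(R/(\boldsymbol{x}),M)\neq 0\}$. -/

import Mathlib

open CategoryTheory

universe u

/-- An `R`-module `M` is `Ext`-finite if `Ext^i_R(N, M)` is a finitely generated `R`-module for
every finitely generated `R`-module `N` and every `i ≥ 1`. -/
def IsExtFinite (R : Type u) [CommRing R] (M : Type u) [AddCommGroup M] [Module R M] : Prop :=
  ∀ (N : Type u) [AddCommGroup N] [Module R N] [Module.Finite R N] (i : ℕ), 1 ≤ i →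
    Module.Finite R (Abelian.Ext.{u} (ModuleCat.of R N) (ModuleCat.of R M) i)

/-- A complex of `R`-modules, indexed by `ℤ` with differentials `X_i → X_{i-1}`, is bounded above
if `X_i = 0` for all large `i`. -/
def IsBoundedAboveComplex {R : Type u} [CommRing R] (X : ChainComplex (ModuleCat.{u} R) ℤ) :
    Prop :=
  ∃ b : ℤ, ∀ i : ℤ, b < i → Subsingleton (X.X i)

/-- A complex is bounded if `X_i = 0` for all but finitely many `i`. -/
def IsBoundedComplex {R : Type u} [CommRing R] (X : ChainComplex (ModuleCat.{u} R) ℤ) : Prop :=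
  ∃ a b : ℤ, ∀ i : ℤ, i < a ∨ b < i → Subsingleton (X.X i)

/-- A quasi-injective resolution of `M`: a bounded above complex `I` of injective `R`-modules whose
homology modules are finite direct sums `H_i(I) ≅ M^{b_i}`, with the `b_i` not all zero.
(Above `sup I` the homology vanishes, so the condition there only says `b_i = 0` when `M ≠ 0`.) -/
structure IsQuasiInjectiveResolution (R : Type u) [CommRing R] (M : Type u) [AddCommGroup M]
    [Module R M] (I : ChainComplex (ModuleCat.{u} R) ℤ) : Prop where
  boundedAbove : IsBoundedAboveComplex I
  injective : ∀ i : ℤ, Injective (I.X i)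
  homology : ∃ b : ℤ → ℕ, (∃ i : ℤ, b i ≠ 0) ∧
    ∀ i : ℤ, Nonempty (I.homology i ≃ₗ[R] (Fin (b i) → M))

open Classical in
/-- The quasi-injective dimension of `M`: `-∞` if `M = 0`, and otherwise the infimum of the numbers
`hinf I - inf I`, where `I` runs over the bounded quasi-injective resolutions of `M`
(`⊤` if there are none). Here `inf I = s` is the least index of a nonzero term of `I`, and
`hinf I = h` is the least index of a nonzero homology module; for `M ≠ 0` both exist. -/
noncomputable def quasiInjectiveDimension (R : Type u) [CommRing R] (M : Type u) [AddCommGroup M]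
    [Module R M] : WithBot ℕ∞ :=
  if Subsingleton M then ⊥
  else sInf {e : WithBot ℕ∞ | ∃ I : ChainComplex (ModuleCat.{u} R) ℤ,
    IsQuasiInjectiveResolution R M I ∧ IsBoundedComplex I ∧
    ∃ (h s : ℤ) (n : ℕ),
      IsLeast {i : ℤ | Nontrivial (I.homology i)} h ∧
      IsLeast {i : ℤ | Nontrivial (I.X i)} s ∧
      h - s = (n : ℤ) ∧ e = (n : WithBot ℕ∞)}

/-- `x = x₁, …, xₙ` (possibly `n = 0`) is a maximal `R`-sequence in the maximal ideal `𝔪` of the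
local ring `R`: it is an `R`-regular sequence of elements of `𝔪` which cannot be prolonged by an
element of `𝔪` to a longer `R`-regular sequence. -/
structure IsMaximalRegularSequence (R : Type u) [CommRing R] [IsLocalRing R] (x : List R) :
    Prop where
  mem : ∀ r ∈ x, r ∈ IsLocalRing.maximalIdeal R
  regular : RingTheory.Sequence.IsRegular R x
  maximal : ∀ y ∈ IsLocalRing.maximalIdeal R, ¬ RingTheory.Sequence.IsRegular R (x ++ [y])

/-! Write Z_i and B_i for the cycles and boundaries of a quasi-injective resolution I with s = inf I
and hinf I = s + n, n minimal. Everything comes from the sequences 0 → Z_{i+1} → I_{i+1} → B_i → 0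
and 0 → B_i → Z_i → H_i → 0, where H_i is a finite power of M and Ext^j(-, I_i) = 0 for j ≥ 1.

Upper bound: R/(x) has finite projective dimension, so Ext(R/(x), M) vanishes in large degrees, and
this passes to all Z_i by descending induction. As B_i = Z_i below s + n and Z_s = I_s, the module
Z_{s+n} has injective dimension at most n. Hence a highest nonvanishing degree above n is impossible
(`ExtModule.subsingleton_of_forall_lt`).

Nonvanishing at n > 0: otherwise, going down from s + n to s + 1, each step gains one degree of
vanishing, and Ext^1(R/(x), Z_{s+1}) = 0. Here Z_{s+1} has injective dimension at most 1, and k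
embeds in R/(x) since x is maximal, so Ext^1(k, Z_{s+1}) = 0. Ext-finiteness and Nakayama make
Z_{s+1} injective (`ExtModule.injective_of_residueField`), and truncating I there contradicts the
minimality of n. -/

section ExtSequences

variable {R : Type u} [CommRing R]

/-- `Ext` of unbundled modules. -/
abbrev ExtModule (R : Type u) [CommRing R] (N X : Type u) [AddCommGroup N] [Module R N]
    [AddCommGroup X] [Module R X] (i : ℕ) : Type u :=
  Abelian.Ext.{u} (ModuleCat.of R N) (ModuleCat.of R X) i

/-- The short complex of `R`-modules given by two composable linear maps. -/
abbrev LinearMap.toShortComplex {A B C : Type u} [AddCommGroup A] [Module R A] [AddCommGroup B]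
    [Module R B] [AddCommGroup C] [Module R C] {f : A →ₗ[R] B} {g : B →ₗ[R] C}
    (h : Function.Exact f g) : ShortComplex (ModuleCat.{u} R) :=
  ShortComplex.mk (ModuleCat.ofHom f) (ModuleCat.ofHom g)
    (by ext x; exact h.apply_apply_eq_zero x)

variable {A B C : Type u} [AddCommGroup A] [Module R A] [AddCommGroup B]
  [Module R B] [AddCommGroup C] [Module R C] {f : A →ₗ[R] B} {g : B →ₗ[R] C}
  (N : Type u) [AddCommGroup N] [Module R N]

lemma LinearMap.toShortComplex_shortExact (h : Function.Exact f g) (hf : Function.Injective f)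
    (hg : Function.Surjective g) : (LinearMap.toShortComplex h).ShortExact :=
  ModuleCat.shortComplex_shortExact _ h hf hg

/-! ### Vanishing and finiteness along long exact Ext sequences -/

namespace ExtModule

lemma subsingleton_of_injective (N X : Type u) [AddCommGroup N] [Module R N] [AddCommGroup X]
    [Module R X] [Injective (ModuleCat.of R X)] {i : ℕ} (hi : 1 ≤ i) :
    Subsingleton (ExtModule R N X i) := by
  obtain ⟨j, rfl⟩ := Nat.exists_eq_add_of_le' hi
  exact Abelian.Ext.subsingleton_of_injective _ _ _

lemma subsingleton_middle (h : Function.Exact f g) (hf : Function.Injective f)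
    (hg : Function.Surjective g) {i : ℕ} (hA : Subsingleton (ExtModule R N A i))
    (hC : Subsingleton (ExtModule R N C i)) : Subsingleton (ExtModule R N B i) := by
  refine subsingleton_of_forall_eq 0 fun y ↦ ?_
  obtain ⟨z, rfl⟩ := Abelian.Ext.covariant_sequence_exact₂ (ModuleCat.of R N)
    (LinearMap.toShortComplex_shortExact h hf hg) y (hC.elim _ _)
  rw [hA.elim z 0, Abelian.Ext.zero_comp]

lemma subsingleton_right (h : Function.Exact f g) (hf : Function.Injective f)
    (hg : Function.Surjective g) {i : ℕ} (hB : Subsingleton (ExtModule R N B i))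
    (hA : Subsingleton (ExtModule R N A (i + 1))) : Subsingleton (ExtModule R N C i) := by
  refine subsingleton_of_forall_eq 0 fun y ↦ ?_
  obtain ⟨z, rfl⟩ := Abelian.Ext.covariant_sequence_exact₃ (ModuleCat.of R N)
    (LinearMap.toShortComplex_shortExact h hf hg) y rfl (hA.elim _ _)
  rw [hB.elim z 0, Abelian.Ext.zero_comp]

lemma subsingleton_left (h : Function.Exact f g) (hf : Function.Injective f)
    (hg : Function.Surjective g) {i : ℕ} (hC : Subsingleton (ExtModule R N C i))
    (hB : Subsingleton (ExtModule R N B (i + 1))) : Subsingleton (ExtModule R N A (i + 1)) := by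
  refine subsingleton_of_forall_eq 0 fun y ↦ ?_
  obtain ⟨z, rfl⟩ := Abelian.Ext.covariant_sequence_exact₁ (ModuleCat.of R N)
    (LinearMap.toShortComplex_shortExact h hf hg) y (hB.elim _ _) rfl
  rw [hC.elim z 0, Abelian.Ext.zero_comp]

lemma finite_middle [IsNoetherianRing R] (h : Function.Exact f g) (hf : Function.Injective f)
    (hg : Function.Surjective g) {i : ℕ} (hA : Module.Finite R (ExtModule R N A i))
    (hC : Module.Finite R (ExtModule R N C i)) : Module.Finite R (ExtModule R N B i) := by
  have : IsNoetherian R (ExtModule R N B i) := isNoetherian_of_range_eq_ker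
    ((Abelian.Ext.mk₀ (ModuleCat.ofHom f)).postcompOfLinear R (ModuleCat.of R N) (add_zero i))
    ((Abelian.Ext.mk₀ (ModuleCat.ofHom g)).postcompOfLinear R (ModuleCat.of R N) (add_zero i)) <| by
      ext y
      constructor
      · rintro ⟨z, rfl⟩
        simpa using congr(z.comp (Abelian.Ext.mk₀ $((LinearMap.toShortComplex h).zero))
          (add_zero i))
      · intro hy
        exact Abelian.Ext.covariant_sequence_exact₂ (ModuleCat.of R N)
          (LinearMap.toShortComplex_shortExact h hf hg) y hy
  infer_instance

/-- The connecting map is injective because Ext^i(N, B) = 0. -/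
lemma finite_right [IsNoetherianRing R] (h : Function.Exact f g) (hf : Function.Injective f)
    (hg : Function.Surjective g) {i : ℕ} (hB : Subsingleton (ExtModule R N B i))
    (hA : Module.Finite R (ExtModule R N A (i + 1))) : Module.Finite R (ExtModule R N C i) := by
  refine Module.Finite.of_injective
    ((LinearMap.toShortComplex_shortExact h hf hg).extClass.postcompOfLinear R
      (ModuleCat.of R N) rfl) ?_
  rw [injective_iff_map_eq_zero]
  intro y hy
  obtain ⟨z, rfl⟩ := Abelian.Ext.covariant_sequence_exact₃ (ModuleCat.of R N)
    (LinearMap.toShortComplex_shortExact h hf hg) y rfl hy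
  rw [hB.elim z 0, Abelian.Ext.zero_comp]

/-- Contravariant sequence: vanishing in the middle. -/
lemma subsingleton_middle' (h : Function.Exact f g) (hf : Function.Injective f)
    (hg : Function.Surjective g) {i : ℕ} (hA : Subsingleton (ExtModule R A N i))
    (hC : Subsingleton (ExtModule R C N i)) : Subsingleton (ExtModule R B N i) := by
  refine subsingleton_of_forall_eq 0 fun y ↦ ?_
  obtain ⟨z, rfl⟩ := Abelian.Ext.contravariant_sequence_exact₂
    (LinearMap.toShortComplex_shortExact h hf hg) (ModuleCat.of R N) y (hA.elim _ _)
  rw [hC.elim z 0, Abelian.Ext.comp_zero]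

/-- Contravariant sequence: vanishing on the submodule. -/
lemma subsingleton_left' (h : Function.Exact f g) (hf : Function.Injective f)
    (hg : Function.Surjective g) {i : ℕ} (hB : Subsingleton (ExtModule R B N i))
    (hC : Subsingleton (ExtModule R C N (1 + i))) : Subsingleton (ExtModule R A N i) := by
  refine subsingleton_of_forall_eq 0 fun y ↦ ?_
  obtain ⟨z, rfl⟩ := Abelian.Ext.contravariant_sequence_exact₁
    (LinearMap.toShortComplex_shortExact h hf hg) (ModuleCat.of R N) y rfl (hC.elim _ _)
  rw [hB.elim z 0, Abelian.Ext.comp_zero]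

lemma ofHom_symm_comp_ofHom (e : B ≃ₗ[R] C) :
    ModuleCat.ofHom (e.symm : C →ₗ[R] B) ≫ ModuleCat.ofHom (e : B →ₗ[R] C) = 𝟙 _ := by
  ext x
  simp

lemma subsingleton_congr_right (e : B ≃ₗ[R] C) (i : ℕ) (hB : Subsingleton (ExtModule R N B i)) :
    Subsingleton (ExtModule R N C i) := by
  refine subsingleton_of_forall_eq 0 fun y ↦ ?_
  have := hB.elim (y.comp (Abelian.Ext.mk₀ e.toModuleIso.inv) (add_zero i)) 0
  simpa [ofHom_symm_comp_ofHom] using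
    congr(($this).comp (Abelian.Ext.mk₀ e.toModuleIso.hom) (add_zero i))

lemma subsingleton_congr_left (e : B ≃ₗ[R] C) (i : ℕ) (hB : Subsingleton (ExtModule R B N i)) :
    Subsingleton (ExtModule R C N i) := by
  refine subsingleton_of_forall_eq 0 fun y ↦ ?_
  have := hB.elim ((Abelian.Ext.mk₀ e.toModuleIso.hom).comp y (zero_add i)) 0
  simpa [ofHom_symm_comp_ofHom] using
    congr((Abelian.Ext.mk₀ e.toModuleIso.inv).comp ($this) (zero_add i))

lemma finite_congr_right (e : B ≃ₗ[R] C) (i : ℕ) (hB : Module.Finite R (ExtModule R N B i)) :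
    Module.Finite R (ExtModule R N C i) := by
  refine Module.Finite.of_surjective ((Abelian.Ext.mk₀ e.toModuleIso.hom).postcompOfLinear R
    (ModuleCat.of R N) (add_zero i)) fun y ↦
    ⟨y.comp (Abelian.Ext.mk₀ e.toModuleIso.inv) (add_zero i), ?_⟩
  simp [ofHom_symm_comp_ofHom]

lemma subsingleton_of_subsingleton_right [Subsingleton B] (i : ℕ) :
    Subsingleton (ExtModule R N B i) := by
  refine subsingleton_of_forall_eq 0 fun y ↦ ?_
  have h : 𝟙 (ModuleCat.of R B) = 0 := by ext x; exact Subsingleton.elim _ _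
  simpa using congr(y.comp (Abelian.Ext.mk₀ $h) (add_zero i))

lemma subsingleton_of_subsingleton_left [Subsingleton B] (i : ℕ) :
    Subsingleton (ExtModule R B N i) := by
  refine subsingleton_of_forall_eq 0 fun y ↦ ?_
  have h : 𝟙 (ModuleCat.of R B) = 0 := by ext x; exact Subsingleton.elim _ _
  simpa using congr((Abelian.Ext.mk₀ $h).comp y (zero_add i))

variable (M : Type u) [AddCommGroup M] [Module R M]

lemma exact_piFinSucc (b : ℕ) : Function.Exact
    (LinearMap.single R (fun _ : Fin (b + 1) ↦ M) 0)
    (LinearMap.funLeft R M (Fin.succ : Fin b → Fin (b + 1))) := by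
  intro x
  constructor
  · intro hx
    refine ⟨x 0, ?_⟩
    ext i
    refine Fin.cases (by simp) (fun j ↦ ?_) i
    simpa using (congr_fun hx j).symm
  · rintro ⟨m, rfl⟩
    ext i
    simp [LinearMap.funLeft_apply]

lemma surjective_piFinSucc (b : ℕ) : Function.Surjective
    (LinearMap.funLeft R M (Fin.succ : Fin b → Fin (b + 1))) :=
  LinearMap.funLeft_surjective_of_injective _ _ _ (Fin.succ_injective b)

lemma subsingleton_pi {i : ℕ} (h : Subsingleton (ExtModule R N M i)) (b : ℕ) :
    Subsingleton (ExtModule R N (Fin b → M) i) := by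
  induction b with
  | zero => exact subsingleton_of_subsingleton_right N i
  | succ b ih =>
    exact subsingleton_middle N (exact_piFinSucc M b)
      (Pi.single_injective (M := fun _ : Fin (b + 1) ↦ M) 0)
      (surjective_piFinSucc M b) h ih

lemma finite_pi [IsNoetherianRing R] {i : ℕ} (h : Module.Finite R (ExtModule R N M i)) (b : ℕ) :
    Module.Finite R (ExtModule R N (Fin b → M) i) := by
  induction b with
  | zero =>
    have := subsingleton_of_subsingleton_right (R := R) (B := Fin 0 → M) N i
    infer_instance
  | succ b ih =>
    exact finite_middle N (exact_piFinSucc M b)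
      (Pi.single_injective (M := fun _ : Fin (b + 1) ↦ M) 0)
      (surjective_piFinSucc M b) h ih

/-- M is a retract of M^b for b ≠ 0, and Ext preserves retracts. -/
lemma subsingleton_of_pi {i b : ℕ} (hb : b ≠ 0) (h : Subsingleton (ExtModule R N (Fin b → M) i)) :
    Subsingleton (ExtModule R N M i) := by
  obtain ⟨b, rfl⟩ := Nat.exists_eq_succ_of_ne_zero hb
  refine subsingleton_of_forall_eq 0 fun y ↦ ?_
  let p : ModuleCat.of R (Fin (b + 1) → M) ⟶ ModuleCat.of R M :=
    ModuleCat.ofHom (LinearMap.proj 0)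
  let j : ModuleCat.of R M ⟶ ModuleCat.of R (Fin (b + 1) → M) :=
    ModuleCat.ofHom (LinearMap.single R (fun _ ↦ M) 0)
  have hjp : j ≫ p = 𝟙 _ := by ext x; simp [j, p]
  have := h.elim (y.comp (Abelian.Ext.mk₀ j) (add_zero i)) 0
  simpa [hjp] using congr(($this).comp (Abelian.Ext.mk₀ p) (add_zero i))

end ExtModule

end ExtSequences

/-! ### Cycles, boundaries and homology of complexes of modules -/

namespace HomologicalComplex

variable {R : Type u} [CommRing R] (K : ChainComplex (ModuleCat.{u} R) ℤ)

/-- The submodule of cycles of a complex of modules. -/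
def cycleSubmodule (i : ℤ) : Submodule R (K.X i) := LinearMap.ker (K.d i (i - 1)).hom

/-- The submodule of boundaries of a complex of modules. -/
def boundarySubmodule (i : ℤ) : Submodule R (K.X i) := LinearMap.range (K.d (i + 1) i).hom

lemma mem_cycleSubmodule {i j : ℤ} (h : j + 1 = i) (x : K.X i) :
    x ∈ K.cycleSubmodule i ↔ (K.d i j).hom x = 0 := by
  obtain rfl : j = i - 1 := by lia
  rfl

lemma d_hom_d_hom (i j k : ℤ) (x : K.X i) : (K.d j k).hom ((K.d i j).hom x) = 0 := by
  rw [← LinearMap.comp_apply, ← ModuleCat.hom_comp, K.d_comp_d]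
  rfl

lemma boundarySubmodule_le_cycleSubmodule (i : ℤ) :
    K.boundarySubmodule i ≤ K.cycleSubmodule i := by
  rintro _ ⟨y, rfl⟩
  exact K.d_hom_d_hom _ _ _ y

/-- Homology of a complex of modules as cycles modulo boundaries. -/
noncomputable def homologyEquivCyclesQuotient (i : ℤ) :
    K.homology i ≃ₗ[R]
      K.cycleSubmodule i ⧸ (K.boundarySubmodule i).submoduleOf (K.cycleSubmodule i) :=
  ((ShortComplex.homologyMapIso (K.isoSc' (i + 1) i (i - 1) (by simp) (by simp))).trans
      (K.sc' (i + 1) i (i - 1)).moduleCatHomologyIso).toLinearEquiv.trans <|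
    Submodule.quotEquivOfEq _ _ <| by
      ext x
      simp only [LinearMap.mem_range, Submodule.submoduleOf,
        boundarySubmodule]
      exact exists_congr fun y ↦ Subtype.ext_iff

/-- The differential onto the boundaries. -/
def toBoundarySubmodule (i : ℤ) : K.X (i + 1) →ₗ[R] K.boundarySubmodule i :=
  (K.d (i + 1) i).hom.rangeRestrict

lemma toBoundarySubmodule_surjective (i : ℤ) : Function.Surjective (K.toBoundarySubmodule i) :=
  LinearMap.surjective_rangeRestrict _

lemma exact_subtype_toBoundarySubmodule (i : ℤ) :
    Function.Exact (K.cycleSubmodule (i + 1)).subtype (K.toBoundarySubmodule i) := by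
  intro x
  rw [Submodule.coe_subtype, Subtype.range_coe_subtype]
  refine Subtype.ext_iff.trans (K.mem_cycleSubmodule rfl x).symm

lemma exact_inclusion_mkQ (i : ℤ) : Function.Exact
    (Submodule.inclusion (K.boundarySubmodule_le_cycleSubmodule i))
    ((K.boundarySubmodule i).submoduleOf (K.cycleSubmodule i)).mkQ := by
  rw [LinearMap.exact_iff, Submodule.ker_mkQ, Submodule.range_inclusion]
  rfl

lemma boundarySubmodule_eq_cycleSubmodule {i : ℤ} (h : Subsingleton (K.homology i)) :
    K.boundarySubmodule i = K.cycleSubmodule i := by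
  refine le_antisymm (K.boundarySubmodule_le_cycleSubmodule i) ?_
  have := (K.homologyEquivCyclesQuotient i).symm.toEquiv.subsingleton
  rwa [Submodule.Quotient.subsingleton_iff, Submodule.submoduleOf_eq_top] at this

end HomologicalComplex

/-! ### Ext into the cycles of a quasi-injective resolution -/

section ExtOfCycles

open HomologicalComplex

variable {R : Type u} [CommRing R] {M : Type u} [AddCommGroup M] [Module R M]
  {I : ChainComplex (ModuleCat.{u} R) ℤ} (N : Type u) [AddCommGroup N] [Module R N]

lemma ExtModule.subsingleton_of_isQuasiInjectiveResolution
    (hI : IsQuasiInjectiveResolution R M I) (i : ℤ) {j : ℕ}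
    (hj : 1 ≤ j) : Subsingleton (ExtModule R N (I.X i) j) := by
  have : Injective (ModuleCat.of R (I.X i)) := hI.injective i
  exact subsingleton_of_injective N _ hj

lemma ExtModule.subsingleton_cyclesQuotient (hI : IsQuasiInjectiveResolution R M I) (i : ℤ) {j : ℕ}
    (h : Subsingleton (ExtModule R N M j)) : Subsingleton (ExtModule R N
      (I.cycleSubmodule i ⧸ (I.boundarySubmodule i).submoduleOf (I.cycleSubmodule i)) j) := by
  obtain ⟨b, -, hb⟩ := hI.homology
  obtain ⟨e⟩ := hb i
  exact subsingleton_congr_right N (e.symm.trans (I.homologyEquivCyclesQuotient i)) j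
    (subsingleton_pi N M h (b i))

lemma ExtModule.finite_cyclesQuotient [IsNoetherianRing R]
    (hI : IsQuasiInjectiveResolution R M I) (i : ℤ) {j : ℕ}
    (h : Module.Finite R (ExtModule R N M j)) : Module.Finite R (ExtModule R N
      (I.cycleSubmodule i ⧸ (I.boundarySubmodule i).submoduleOf (I.cycleSubmodule i)) j) := by
  obtain ⟨b, -, hb⟩ := hI.homology
  obtain ⟨e⟩ := hb i
  exact finite_congr_right N (e.symm.trans (I.homologyEquivCyclesQuotient i)) j
    (finite_pi N M h (b i))

/-- A property of complexes bounded above can be proved by descending induction. -/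
lemma IsBoundedAboveComplex.induction (hI : IsBoundedAboveComplex I) {P : ℤ → Prop}
    (zero : ∀ i, Subsingleton (I.X i) → P i) (step : ∀ i, P (i + 1) → P i) (i : ℤ) : P i := by
  obtain ⟨b, hb⟩ := hI
  by_cases h : b < i
  · exact zero i (hb i h)
  -- The count starts at b + 1, the first degree where the term is known to vanish.
  · have hn : ∀ n : ℕ, P (b + 1 - n) := by
      intro n
      induction n with
      | zero => exact zero _ (hb _ (by simp))
      | succ n ih => exact step _ (by convert ih using 1; push_cast; ring)
    convert hn (b + 1 - i).toNat using 1
    lia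

/-- Dimension shift through the injective term I_{i+1}. -/
lemma ExtModule.subsingleton_boundarySubmodule (hI : IsQuasiInjectiveResolution R M I) {i : ℤ}
    {j : ℕ} (hj : 1 ≤ j) (h : Subsingleton (ExtModule R N (I.cycleSubmodule (i + 1)) (j + 1))) :
    Subsingleton (ExtModule R N (I.boundarySubmodule i) j) :=
  subsingleton_right N (I.exact_subtype_toBoundarySubmodule i) (Submodule.subtype_injective _)
    (I.toBoundarySubmodule_surjective i) (subsingleton_of_isQuasiInjectiveResolution N hI _ hj) h

/-- Vanishing of `Ext` above a degree passes from `M` to the cycles of a quasi-injective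
resolution of `M`. -/
lemma ExtModule.subsingleton_cycleSubmodule (hI : IsQuasiInjectiveResolution R M I) {t : ℕ}
    (h : ∀ j, t < j → Subsingleton (ExtModule R N M j)) (i : ℤ) :
    ∀ j, t < j → Subsingleton (ExtModule R N (I.cycleSubmodule i) j) := by
  refine hI.boundedAbove.induction (P := fun i ↦ ∀ j, t < j →
    Subsingleton (ExtModule R N (I.cycleSubmodule i) j)) ?_ ?_ i
  · intro i hi j _
    exact subsingleton_of_subsingleton_right N j
  · intro i ih j hj
    exact subsingleton_middle N (I.exact_inclusion_mkQ i) (Submodule.inclusion_injective _)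
      (Submodule.mkQ_surjective _)
      (subsingleton_boundarySubmodule N hI (by lia) (ih _ (by lia)))
      (subsingleton_cyclesQuotient N hI i (h j hj))

/-- The same descending induction as for vanishing; it makes Nakayama applicable to Ext of the
cycles. -/
lemma ExtModule.finite_cycleSubmodule [IsNoetherianRing R]
    (hI : IsQuasiInjectiveResolution R M I)
    (h : ∀ j, 1 ≤ j → Module.Finite R (ExtModule R N M j)) (i : ℤ) :
    ∀ j, 1 ≤ j → Module.Finite R (ExtModule R N (I.cycleSubmodule i) j) := by
  refine hI.boundedAbove.induction (P := fun i ↦ ∀ j, 1 ≤ j →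
    Module.Finite R (ExtModule R N (I.cycleSubmodule i) j)) ?_ ?_ i
  · intro i hi j _
    have := subsingleton_of_subsingleton_right (R := R) (B := I.cycleSubmodule i) N j
    infer_instance
  · intro i ih j hj
    exact finite_middle N (I.exact_inclusion_mkQ i) (Submodule.inclusion_injective _)
      (Submodule.mkQ_surjective _)
      (finite_right N (I.exact_subtype_toBoundarySubmodule i) (Submodule.subtype_injective _)
        (I.toBoundarySubmodule_surjective i) (subsingleton_of_isQuasiInjectiveResolution N hI _ hj)
        (ih _ (by lia)))
      (finite_cyclesQuotient N hI i (h j hj))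

/-- Below the lowest homology, the vanishing range improves by one in each step. -/
lemma ExtModule.subsingleton_cycleSubmodule_sub (hI : IsQuasiInjectiveResolution R M I) {t : ℕ}
    (h : ∀ j, t < j → Subsingleton (ExtModule R N M j)) {a : ℤ}
    (ha : ∀ i, i < a → Subsingleton (I.homology i)) (n : ℕ) :
    ∀ j, 1 ≤ j → t < j + n → Subsingleton (ExtModule R N (I.cycleSubmodule (a - n)) j) := by
  induction n with
  | zero => exact fun j _ hj ↦ subsingleton_cycleSubmodule N hI h _ j hj
  | succ n ih =>
    intro j hj hjn
    have e : a - (n + 1 : ℕ) + 1 = a - n := by push_cast; ring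
    -- Without homology, passing from Z_{i+1} to Z_i = B_i is a pure dimension shift.
    rw [← I.boundarySubmodule_eq_cycleSubmodule (ha _ (by lia))]
    refine subsingleton_boundarySubmodule N hI hj ?_
    rw [e]
    exact ih (j + 1) (by lia) (by lia)

/-- The cycles in degree `s + n` have injective dimension at most `n` if `I` vanishes below
degree `s` and is exact below degree `s + n`. -/
lemma ExtModule.subsingleton_cycleSubmodule_add (hI : IsQuasiInjectiveResolution R M I) {s : ℤ}
    (hs : ∀ i, i < s → Subsingleton (I.X i)) (n : ℕ)
    (hn : ∀ i, i < s + n → Subsingleton (I.homology i)) :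
    ∀ j, n < j → Subsingleton (ExtModule R N (I.cycleSubmodule (s + n)) j) := by
  induction n with
  | zero =>
    intro j hj
    -- The differential out of degree s has zero target, so Z_s = I_s is injective.
    have e : I.cycleSubmodule (s + (0 : ℕ)) = ⊤ := by
      refine eq_top_iff.2 fun x _ ↦ (I.mem_cycleSubmodule (sub_add_cancel _ 1) x).2 ?_
      have := hs (s + (0 : ℕ) - 1) (by simp)
      exact Subsingleton.elim _ _
    rw [e]
    exact subsingleton_congr_right N Submodule.topEquiv.symm j
      (subsingleton_of_isQuasiInjectiveResolution N hI _ (by lia))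
  | succ n ih =>
    intro j hj
    obtain ⟨j, rfl⟩ := Nat.exists_eq_add_of_le' (show 1 ≤ j by lia)
    have e : s + (n + 1 : ℕ) = s + n + 1 := by push_cast; ring
    rw [e]
    refine subsingleton_left N (I.exact_subtype_toBoundarySubmodule (s + n))
      (Submodule.subtype_injective _) (I.toBoundarySubmodule_surjective _) ?_
      (subsingleton_of_isQuasiInjectiveResolution N hI _ (by lia))
    rw [I.boundarySubmodule_eq_cycleSubmodule (hn _ (by lia))]
    exact ih (fun i hi ↦ hn i (by lia)) j (by lia)

/-- The largest degree in which `Ext(N, M)` does not vanish is at most `n`, the length of a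
quasi-injective resolution below its lowest homology. -/
lemma ExtModule.subsingleton_of_forall_lt (hI : IsQuasiInjectiveResolution R M I) {s : ℤ} {n : ℕ}
    (hs : ∀ i, i < s → Subsingleton (I.X i))
    (hn : ∀ i, i < s + n → Subsingleton (I.homology i)) (hne : Nontrivial (I.homology (s + n)))
    {m : ℕ} (hm : ∀ j, m < j → Subsingleton (ExtModule R N M j)) (hnm : n < m) :
    Subsingleton (ExtModule R N M m) := by
  obtain ⟨b, -, hb⟩ := hI.homology
  obtain ⟨e⟩ := hb (s + n)
  have hb0 : b (s + n) ≠ 0 := by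
    intro h0
    rw [h0] at e
    exact not_subsingleton _ e.toEquiv.subsingleton
  refine subsingleton_of_pi N M hb0 (subsingleton_congr_right N
    ((I.homologyEquivCyclesQuotient _).symm.trans e) m ?_)
  -- Ext^m(N, H_{s+n}) lies between Ext^m(N, Z_{s+n}), zero as m > n, and Ext^{m+1}(N, B_{s+n}),
  -- zero by a shift to Ext^{m+2}(N, Z_{s+n+1}).
  refine subsingleton_right N (I.exact_inclusion_mkQ _) (Submodule.inclusion_injective _)
      (Submodule.mkQ_surjective _) (subsingleton_cycleSubmodule_add N hI hs n hn m hnm) ?_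
  exact subsingleton_boundarySubmodule N hI (by lia)
    (subsingleton_cycleSubmodule N hI hm _ _ (by lia))

/-- If `Ext(N, M)` vanishes in large degrees, then it vanishes above degree `n`. -/
lemma ExtModule.subsingleton_of_lt (hI : IsQuasiInjectiveResolution R M I) {s : ℤ} {n : ℕ}
    (hs : ∀ i, i < s → Subsingleton (I.X i))
    (hn : ∀ i, i < s + n → Subsingleton (I.homology i)) (hne : Nontrivial (I.homology (s + n)))
    {d : ℕ} (hd : ∀ j, d < j → Subsingleton (ExtModule R N M j)) :
    ∀ j, n < j → Subsingleton (ExtModule R N M j) := by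
  induction d with
  | zero => exact fun j hj ↦ hd j (by lia)
  | succ d ih =>
    by_cases h : d + 1 ≤ n
    · exact fun j hj ↦ hd j (by lia)
    · refine ih fun j hj ↦ ?_
      obtain rfl | hj' := eq_or_lt_of_le (Nat.succ_le_of_lt hj)
      · exact subsingleton_of_forall_lt N hI hs hn hne hd (by lia)
      · exact hd j hj'

end ExtOfCycles

/-! ### Regular sequences, residue field and injectivity over local rings -/

section LocalRing

open IsLocalRing

variable {R : Type u} [CommRing R]

/-- A quotient by a regular sequence has finite projective dimension. -/
lemma ExtModule.subsingleton_of_isRegular [IsLocalRing R] [IsNoetherianRing R] {x : List R}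
    (hx : RingTheory.Sequence.IsRegular R x) (X : Type u) [AddCommGroup X] [Module R X] (j : ℕ)
    (hj : x.length < j) : Subsingleton (ExtModule R (R ⧸ Ideal.ofList x) X j) := by
  have h := ModuleCat.projectiveDimension_quotient_eq_length.{u} x hx
  have : HasProjectiveDimensionLT (ModuleCat.of R (Shrink.{u} (R ⧸ Ideal.ofList x)))
      (x.length + 1) := by
    rw [← HasProjectiveDimensionLE, ← projectiveDimension_le_iff, h]
  exact subsingleton_congr_left X (Shrink.linearEquiv R (R ⧸ Ideal.ofList x)) j
    (HasProjectiveDimensionLT.subsingleton _ (x.length + 1) j hj _)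

/-- The residue field embeds in the quotient by a maximal regular sequence. -/
lemma IsMaximalRegularSequence.exists_injective [IsLocalRing R] [IsNoetherianRing R] {x : List R}
    (hx : IsMaximalRegularSequence R x) :
    ∃ f : (R ⧸ maximalIdeal R) →ₗ[R] (R ⧸ Ideal.ofList x), Function.Injective f := by
  -- By maximality of x, the maximal ideal consists of zero divisors on R/(x).
  have hzd : ∀ y ∈ maximalIdeal R, ¬ IsSMulRegular (R ⧸ Ideal.ofList x) y := by
    intro y hy hreg
    refine hx.maximal y hy (.of_isWeaklyRegular_of_mem_maximalIdeal R ?_ ?_)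
    · intro r hr
      rcases List.mem_append.1 hr with hr | hr
      · exact hx.mem r hr
      · rwa [List.mem_singleton.1 hr]
    · rw [RingTheory.Sequence.isWeaklyRegular_append_iff,
        RingTheory.Sequence.isWeaklyRegular_singleton_iff]
      refine ⟨hx.regular.toIsWeaklyRegular, ?_⟩
      rwa [smul_eq_mul, Ideal.mul_top]
  obtain ⟨p, hp, hle⟩ : ∃ p ∈ associatedPrimes R (R ⧸ Ideal.ofList x), maximalIdeal R ≤ p := by
    have fin := associatedPrimes.finite R (R ⧸ Ideal.ofList x)
    -- Prime avoidance over the finitely many associated primes. The two indices exempt from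
    -- primality are irrelevant, hence the dummy zeros.
    refine ((maximalIdeal R).subset_union_prime_finite fin (f := id) 0 0
      fun _ h _ _ ↦ h.isPrime).1 ?_
    intro y hy
    have := hzd y hy
    simp only [id]
    rw [biUnion_associatedPrimes_eq_zero_divisors]
    rw [isSMulRegular_iff_right_eq_zero_of_smul] at this
    push Not at this
    obtain ⟨m, hm, hm0⟩ := this
    exact ⟨m, hm0, hm⟩
  have hpm : p = maximalIdeal R :=
    ((maximalIdeal.isMaximal R).eq_of_le hp.isPrime.ne_top hle).symm
  subst hpm
  obtain ⟨-, z, hz⟩ := isAssociatedPrime_iff.1 hp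
  have hker : LinearMap.ker (LinearMap.toSpanSingleton R (R ⧸ Ideal.ofList x) z) =
      maximalIdeal R := by
    rw [hz]
    ext r
    simp [Submodule.mem_colon_singleton]
  exact ⟨Submodule.liftQ _ _ hker.ge,
    LinearMap.ker_eq_bot.1 (Submodule.ker_liftQ_eq_bot _ _ hker.ge hker.le)⟩

/-- Baer's criterion in terms of `Ext`. -/
lemma ExtModule.injective_of_forall_ideal (W : Type u) [AddCommGroup W] [Module R W]
    (h : ∀ J : Ideal R, Subsingleton (ExtModule R (R ⧸ J) W 1)) :
    Injective (ModuleCat.of R W) := by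
  rw [← Module.injective_iff_injective_object]
  -- The obstruction to extending g from J to R lies in Ext^1(R/J, W).
  refine Module.Baer.injective (Module.Baer.iff_surjective.2 fun J g ↦ ?_)
  obtain ⟨y, hy⟩ := Abelian.Ext.contravariant_sequence_exact₁
    (LinearMap.toShortComplex_shortExact (LinearMap.exact_subtype_mkQ J)
      (Submodule.subtype_injective J) (Submodule.mkQ_surjective J)) (ModuleCat.of R W)
    (Abelian.Ext.mk₀ (ModuleCat.ofHom g)) rfl ((h J).elim _ _)
  obtain ⟨g', rfl⟩ := (Abelian.Ext.mk₀_bijective _ _).2 y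
  rw [Abelian.Ext.mk₀_comp_mk₀, (Abelian.Ext.mk₀_bijective _ _).1.eq_iff] at hy
  exact ⟨g'.hom, congr(($hy).hom)⟩

/-- If `0 → N → N → C → 0` is multiplication by an element of the maximal ideal, `Ext(N, W)` is
finitely generated and the next `Ext(C, W)` vanishes, then `Ext(N, W)` vanishes by Nakayama. -/
lemma ExtModule.subsingleton_of_isSMulRegular [IsLocalRing R] {N W : Type u} [AddCommGroup N]
    [Module R N] [AddCommGroup W] [Module R W] {a : R} (ha : a ∈ maximalIdeal R)
    (hreg : IsSMulRegular N a) {j : ℕ} (hfin : Module.Finite R (ExtModule R N W j))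
    (h : Subsingleton (ExtModule R (N ⧸ LinearMap.range (LinearMap.lsmul R N a)) W (1 + j))) :
    Subsingleton (ExtModule R N W j) := by
  have hsurj (y : ExtModule R N W j) : ∃ z : ExtModule R N W j, a • z = y := by
    obtain ⟨z, hz⟩ := Abelian.Ext.contravariant_sequence_exact₁
      (LinearMap.toShortComplex_shortExact (LinearMap.exact_map_mkQ_range (LinearMap.lsmul R N a))
        hreg (Submodule.mkQ_surjective _)) (ModuleCat.of R W) y rfl (h.elim _ _)
    refine ⟨z, ?_⟩
    rw [← hz]
    have : ModuleCat.ofHom (LinearMap.lsmul R N a) = a • 𝟙 (ModuleCat.of R N) := by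
      ext x
      rfl
    simp [this, Abelian.Ext.mk₀_smul]
  have htop : (⊤ : Submodule R (ExtModule R N W j)) = ⊥ :=
    Submodule.eq_bot_of_le_smul_of_le_jacobson_bot (maximalIdeal R) ⊤ hfin.fg_top
      (fun y _ ↦ by
        obtain ⟨z, rfl⟩ := hsurj y
        exact Submodule.smul_mem_smul ha trivial)
      (IsLocalRing.jacobson_eq_maximalIdeal ⊥ bot_ne_top).ge
  exact (Submodule.subsingleton_iff R).1 (subsingleton_of_bot_eq_top htop.symm)

/-- Over a Noetherian local ring, a module of injective dimension at most one with finitely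
generated `Ext^1` and `Ext^1(k, W) = 0` is injective. -/
lemma ExtModule.injective_of_residueField [IsLocalRing R] [IsNoetherianRing R] (W : Type u)
    [AddCommGroup W] [Module R W]
    (hfin : ∀ (N : Type u) [AddCommGroup N] [Module R N] [Module.Finite R N],
      Module.Finite R (ExtModule R N W 1))
    (h2 : ∀ (N : Type u) [AddCommGroup N] [Module R N], Subsingleton (ExtModule R N W 2))
    (hk : Subsingleton (ExtModule R (R ⧸ maximalIdeal R) W 1)) :
    Injective (ModuleCat.of R W) := by
  refine injective_of_forall_ideal W fun J ↦ ?_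
  -- A prime filtration reduces R/J to the modules R/p; for p ≠ 𝔪, Nakayama applies to any a in 𝔪
  -- outside p, which is regular on R/p.
  refine IsNoetherianRing.induction_on_isQuotientEquivQuotientPrime R (M := R ⧸ J) inferInstance
    (motive := fun N _ _ _ ↦ Subsingleton (ExtModule R N W 1)) ?_ ?_ ?_
  · intro N _ _ _ _
    exact subsingleton_of_subsingleton_left W 1
  · intro N _ _ _ p e
    refine subsingleton_congr_left W e.symm 1 ?_
    by_cases hp : p.1 = maximalIdeal R
    · rw [hp]
      exact hk
    · obtain ⟨a, ha, hap⟩ := SetLike.exists_of_lt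
        (lt_of_le_of_ne (IsLocalRing.le_maximalIdeal p.2.ne_top) hp)
      refine subsingleton_of_isSMulRegular ha ?_ (hfin _) (h2 _)
      rw [isSMulRegular_iff_right_eq_zero_of_smul]
      intro y hy
      obtain ⟨y, rfl⟩ := Ideal.Quotient.mk_surjective y
      rw [Algebra.smul_def, Ideal.Quotient.algebraMap_eq, ← map_mul,
        Ideal.Quotient.eq_zero_iff_mem] at hy
      exact Ideal.Quotient.eq_zero_iff_mem.2 ((p.2.mem_or_mem hy).resolve_left hap)
  · intro N₁ _ _ _ N₂ _ _ _ N₃ _ _ _ f g hf hg hfg h₁ h₃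
    exact subsingleton_middle' W hfg hf hg h₁ h₃

end LocalRing

/-! ### Canonical truncation -/

namespace HomologicalComplex

variable {R : Type u} [CommRing R] (K : ChainComplex (ModuleCat.{u} R) ℤ) (s : ℤ)

/-- The terms of the canonical truncation of a complex of modules in degrees `≥ s + 1`. -/
def truncationSubmodule (i : ℤ) : Submodule R (K.X i) where
  -- One predicate covers the three ranges of i (zero, cycles, whole term), so the differential
  -- restricts without a case split on types.
  carrier := {x | (i ≤ s → x = 0) ∧ (i = s + 1 → (K.d i (i - 1)).hom x = 0)}
  zero_mem' := by simp
  add_mem' {x y} hx hy := ⟨fun h ↦ by rw [hx.1 h, hy.1 h, add_zero],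
    fun h ↦ by rw [map_add, hx.2 h, hy.2 h, add_zero]⟩
  smul_mem' r x hx := ⟨fun h ↦ by rw [hx.1 h, smul_zero],
    fun h ↦ by rw [map_smul, hx.2 h, smul_zero]⟩

lemma truncationSubmodule_eq_bot {i : ℤ} (hi : i ≤ s) : K.truncationSubmodule s i = ⊥ :=
  (Submodule.eq_bot_iff _).2 fun _ hx ↦ hx.1 hi

lemma truncationSubmodule_eq_top {i : ℤ} (hi : s + 1 < i) : K.truncationSubmodule s i = ⊤ :=
  eq_top_iff.2 fun _ _ ↦ ⟨fun h ↦ by lia, fun h ↦ by lia⟩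

lemma truncationSubmodule_succ : K.truncationSubmodule s (s + 1) = K.cycleSubmodule (s + 1) := by
  ext x
  exact ⟨fun h ↦ h.2 rfl, fun h ↦ ⟨fun h' ↦ by lia, fun _ ↦ h⟩⟩

lemma d_mem_truncationSubmodule (i j : ℤ) (x : K.X i) (hx : x ∈ K.truncationSubmodule s i) :
    (K.d i j).hom x ∈ K.truncationSubmodule s j := by
  by_cases h : j + 1 = i
  · obtain rfl : j = i - 1 := by lia
    refine ⟨fun h ↦ ?_, fun _ ↦ K.d_hom_d_hom _ _ _ x⟩
    by_cases hi : i ≤ s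
    · rw [hx.1 hi, map_zero]
    · exact hx.2 (by lia)
  · rw [K.shape i j h]
    exact zero_mem _

/-- The canonical truncation of a complex of modules in degrees `≥ s + 1`. -/
def moduleTruncation : ChainComplex (ModuleCat.{u} R) ℤ where
  X i := ModuleCat.of R (K.truncationSubmodule s i)
  d i j := ModuleCat.ofHom
    ((K.d i j).hom.restrict fun x hx ↦ K.d_mem_truncationSubmodule s i j x hx)
  shape i j h := by
    ext x
    simp [LinearMap.restrict_apply, K.shape i j h]
  d_comp_d' i j k _ _ :=
    ModuleCat.hom_ext (LinearMap.ext fun x ↦ Subtype.ext (K.d_hom_d_hom i j k x.1))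

/-- The cycles of the truncation agree with those of the complex in degrees `≥ s + 1`. -/
noncomputable def moduleTruncationCyclesEquiv {i : ℤ} (hi : s < i) :
    (K.moduleTruncation s).cycleSubmodule i ≃ₗ[R] K.cycleSubmodule i where
  toFun x := ⟨x.1.1, congr_arg Subtype.val x.2⟩
  map_add' _ _ := rfl
  map_smul' _ _ := rfl
  invFun x := ⟨⟨x.1, fun h ↦ by lia, fun _ ↦ x.2⟩, Subtype.ext x.2⟩
  left_inv _ := rfl
  right_inv _ := rfl

/-- The homology of the truncation agrees with that of the complex in degrees `≥ s + 1`. -/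
noncomputable def moduleTruncationHomologyEquiv {i : ℤ} (hi : s < i) :
    (K.moduleTruncation s).homology i ≃ₗ[R] K.homology i :=
  ((K.moduleTruncation s).homologyEquivCyclesQuotient i).trans <|
    (Submodule.Quotient.equiv _ _ (K.moduleTruncationCyclesEquiv s hi) <| by
      ext x
      constructor
      · rintro ⟨_, ⟨y, hy⟩, rfl⟩
        exact ⟨y.1, congr_arg Subtype.val hy⟩
      · rintro ⟨y, hy⟩
        refine ⟨(K.moduleTruncationCyclesEquiv s hi).symm x, ?_, by simp⟩
        -- The preimage y has degree i + 1 > s + 1, where the truncation is the whole term.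
        exact ⟨⟨y, fun h ↦ by lia, fun h ↦ by lia⟩, Subtype.ext hy⟩).trans
    (K.homologyEquivCyclesQuotient i).symm

lemma moduleTruncation_subsingleton {i : ℤ} (h : i ≤ s ∨ Subsingleton (K.X i)) :
    Subsingleton ((K.moduleTruncation s).X i) := by
  rcases h with h | h
  · change Subsingleton (K.truncationSubmodule s i)
    rw [K.truncationSubmodule_eq_bot s h]
    infer_instance
  · exact inferInstanceAs (Subsingleton (K.truncationSubmodule s i))

end HomologicalComplex

open HomologicalComplex

variable {R : Type u} [CommRing R]

lemma HomologicalComplex.subsingleton_homology {K : ChainComplex (ModuleCat.{u} R) ℤ} {i : ℤ}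
    (h : Subsingleton (K.X i)) : Subsingleton (K.homology i) :=
  (K.homologyEquivCyclesQuotient i).toEquiv.subsingleton

/-- If the cycles in degree `s + 1` are injective and there is no homology in degrees `≤ s`, then
the canonical truncation is again a quasi-injective resolution. -/
lemma IsQuasiInjectiveResolution.moduleTruncation {M : Type u} [AddCommGroup M] [Module R M]
    {I : ChainComplex (ModuleCat.{u} R) ℤ} (hI : IsQuasiInjectiveResolution R M I) {s : ℤ}
    (hs : ∀ i, i ≤ s → Subsingleton (I.homology i))
    (hinj : Injective (ModuleCat.of R (I.cycleSubmodule (s + 1)))) :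
    IsQuasiInjectiveResolution R M (I.moduleTruncation s) where
  boundedAbove := by
    obtain ⟨b, hb⟩ := hI.boundedAbove
    exact ⟨b, fun i hi ↦ I.moduleTruncation_subsingleton s (.inr (hb i hi))⟩
  injective i := by
    change Injective (ModuleCat.of R (I.truncationSubmodule s i))
    rcases lt_trichotomy i (s + 1) with h | rfl | h
    · rw [I.truncationSubmodule_eq_bot s (by lia)]
      exact (ModuleCat.isZero_of_subsingleton _).injective
    · rwa [I.truncationSubmodule_succ]
    · rw [I.truncationSubmodule_eq_top s h]
      have := hI.injective i
      exact Injective.of_iso (Submodule.topEquiv.symm.toModuleIso :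
        ModuleCat.of R (I.X i) ≅ ModuleCat.of R (⊤ : Submodule R (I.X i))) this
  homology := by
    obtain ⟨b, hb0, hb⟩ := hI.homology
    refine ⟨b, hb0, fun i ↦ ?_⟩
    obtain ⟨e⟩ := hb i
    by_cases h : s < i
    · exact ⟨(I.moduleTruncationHomologyEquiv s h).trans e⟩
    -- In degrees ≤ s both homology modules vanish, so M^{b_i} = 0 and the same b_i still serves.
    · have h₁ := hs i (by lia)
      have h₂ := subsingleton_homology (I.moduleTruncation_subsingleton s (.inl (by lia : i ≤ s)))
      have h₃ := e.symm.toEquiv.subsingleton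
      exact ⟨{ (0 : (I.moduleTruncation s).homology i →ₗ[R] (Fin (b i) → M)) with
        invFun := 0
        left_inv := fun _ ↦ Subsingleton.elim _ _
        right_inv := fun _ ↦ Subsingleton.elim _ _ }⟩

/-! ### Minimal resolutions and the main theorem -/

open HomologicalComplex IsLocalRing

/-- `M` has a bounded quasi-injective resolution `I` with `hinf I - inf I = n`. -/
def HasQuasiInjectiveResolutionOfLength (R : Type u) [CommRing R] (M : Type u) [AddCommGroup M]
    [Module R M] (n : ℕ) : Prop :=
  ∃ I : ChainComplex (ModuleCat.{u} R) ℤ, IsQuasiInjectiveResolution R M I ∧ IsBoundedComplex I ∧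
    ∃ h s : ℤ, IsLeast {i : ℤ | Nontrivial (I.homology i)} h ∧
      IsLeast {i : ℤ | Nontrivial (I.X i)} s ∧ h - s = (n : ℤ)

section

variable {R : Type u} [CommRing R] {M : Type u} [AddCommGroup M] [Module R M]

/-- A finite quasi-injective dimension is attained by a minimal resolution. -/
lemma exists_quasiInjectiveDimension_eq [Nontrivial M] (h : quasiInjectiveDimension R M < ⊤) :
    ∃ n : ℕ, quasiInjectiveDimension R M = n ∧ HasQuasiInjectiveResolutionOfLength R M n ∧
      ∀ m < n, ¬ HasQuasiInjectiveResolutionOfLength R M m := by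
  classical
  rw [quasiInjectiveDimension, if_neg (not_subsingleton M)] at h ⊢
  have hex : ∃ n, HasQuasiInjectiveResolutionOfLength R M n := by
    by_contra! hne
    refine h.ne ?_
    refine (congr_arg sInf (Set.eq_empty_iff_forall_notMem.2 ?_)).trans
      (sInf_empty (α := WithBot ℕ∞))
    rintro e ⟨I, hI, hb, a, s, n, ha, hs, hn, -⟩
    exact hne n ⟨I, hI, hb, a, s, ha, hs, hn⟩
  refine ⟨Nat.find hex, ?_, Nat.find_spec hex, fun m hm ↦ Nat.find_min hex hm⟩
  refine IsLeast.csInf_eq ⟨?_, ?_⟩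
  · obtain ⟨I, hI, hb, a, s, ha, hs, hn⟩ := Nat.find_spec hex
    exact ⟨I, hI, hb, a, s, _, ha, hs, hn, rfl⟩
  · rintro e ⟨I, hI, hb, a, s, n, ha, hs, hn, rfl⟩
    exact_mod_cast Nat.find_min' hex ⟨I, hI, hb, a, s, ha, hs, hn⟩

/-- Truncating a resolution of positive length whose lowest nonzero cycles after the bottom term
are injective gives a shorter resolution. -/
lemma IsQuasiInjectiveResolution.exists_shorter {I : ChainComplex (ModuleCat.{u} R) ℤ}
    (hI : IsQuasiInjectiveResolution R M I) (hb : IsBoundedComplex I) {h s : ℤ}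
    (hh : IsLeast {i : ℤ | Nontrivial (I.homology i)} h) (hsh : s < h)
    (hinj : Injective (ModuleCat.of R (I.cycleSubmodule (s + 1)))) :
    ∃ m : ℕ, (m : ℤ) < h - s ∧ HasQuasiInjectiveResolutionOfLength R M m := by
  have hlow : ∀ i, i < h → Subsingleton (I.homology i) := fun i hi ↦
    not_nontrivial_iff_subsingleton.1 fun h' ↦ absurd (hh.2 h') (by lia)
  have hzero : ∀ i, i ≤ s → Subsingleton ((I.moduleTruncation s).X i) := fun i hi ↦
    I.moduleTruncation_subsingleton s (.inl hi)
  have hh' : IsLeast {i : ℤ | Nontrivial ((I.moduleTruncation s).homology i)} h := by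
    constructor
    · have : Nontrivial (I.homology h) := hh.1
      exact (I.moduleTruncationHomologyEquiv s hsh).toEquiv.nontrivial
    · intro i hi
      by_contra! hlt
      refine not_subsingleton_iff_nontrivial.2 hi ?_
      by_cases his : s < i
      · have := hlow i hlt
        exact (I.moduleTruncationHomologyEquiv s his).toEquiv.subsingleton
      · exact subsingleton_homology (hzero i (by lia))
  have hXh : Nontrivial ((I.moduleTruncation s).X h) := by
    refine not_subsingleton_iff_nontrivial.1 fun h' ↦ ?_
    exact not_subsingleton_iff_nontrivial.2 hh'.1 (subsingleton_homology h')
  -- Z_{s+1} may be zero, so the new bottom degree s' is only known to satisfy s < s' ≤ h.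
  obtain ⟨s', hs', hmin⟩ := Int.exists_least_of_bdd
    (P := fun i ↦ Nontrivial ((I.moduleTruncation s).X i))
    ⟨s, fun i hi ↦ by
      by_contra! hlt
      exact not_subsingleton_iff_nontrivial.2 hi (hzero i hlt.le)⟩ ⟨h, hXh⟩
  have hs's : s < s' := by
    by_contra! hle
    exact not_subsingleton_iff_nontrivial.2 hs' (hzero s' hle)
  have hs'h := hmin h hXh
  obtain ⟨a, b, hab⟩ := hb
  refine ⟨(h - s').toNat, by lia, I.moduleTruncation s,
    hI.moduleTruncation (fun i hi ↦ hlow i (by lia)) hinj,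
    ⟨a, b, fun i hi ↦ I.moduleTruncation_subsingleton s (.inr (hab i hi))⟩,
    h, s', hh', ⟨hs', fun i hi ↦ hmin i hi⟩, by lia⟩

/-- The quasi-injective dimension `n` of an `Ext`-finite module is detected by the quotient by a
maximal regular sequence. -/
lemma exists_quasiInjectiveDimension_eq_ext [IsNoetherianRing R] [IsLocalRing R] [Nontrivial M]
    (hM : IsExtFinite R M) (hqid : quasiInjectiveDimension R M < ⊤) {x : List R}
    (hx : IsMaximalRegularSequence R x) :
    ∃ n : ℕ, quasiInjectiveDimension R M = n ∧
      (∀ j, n < j → Subsingleton (ExtModule R (R ⧸ Ideal.ofList x) M j)) ∧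
      (n ≠ 0 → Nontrivial (ExtModule R (R ⧸ Ideal.ofList x) M n)) := by
  obtain ⟨n, hn, ⟨I, hI, hb, h, s, hh, hs, hhs⟩, hmin⟩ := exists_quasiInjectiveDimension_eq hqid
  obtain rfl : h = s + n := by lia
  have hlow : ∀ i, i < s + n → Subsingleton (I.homology i) := fun i hi ↦
    not_nontrivial_iff_subsingleton.1 fun h' ↦ absurd (hh.2 h') (by lia)
  have hX : ∀ i, i < s → Subsingleton (I.X i) := fun i hi ↦
    not_nontrivial_iff_subsingleton.1 fun h' ↦ absurd (hs.2 h') (by lia)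
  have hvan := ExtModule.subsingleton_of_lt (R ⧸ Ideal.ofList x) hI hX hlow hh.1
    (ExtModule.subsingleton_of_isRegular hx.regular M)
  refine ⟨n, hn, hvan, fun hn0 ↦ not_subsingleton_iff_nontrivial.1 fun hsub ↦ ?_⟩
  obtain ⟨n, rfl⟩ := Nat.exists_eq_succ_of_ne_zero hn0
  have hvan' : ∀ j, n < j → Subsingleton (ExtModule R (R ⧸ Ideal.ofList x) M j) := by
    intro j hj
    obtain rfl | hj' := eq_or_lt_of_le (Nat.succ_le_of_lt hj)
    · exact hsub
    · exact hvan j hj'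
  -- The dimension is now n + 1; n steps down from s + n + 1 lead to s + 1 and turn vanishing above
  -- n into vanishing from degree 1 on.
  have hW1 := ExtModule.subsingleton_cycleSubmodule_sub _ hI hvan' hlow n 1 le_rfl (by lia)
  rw [show s + (n + 1 : ℕ) - n = s + 1 by push_cast; ring] at hW1
  have hW2 (N : Type u) [AddCommGroup N] [Module R N] :
      Subsingleton (ExtModule R N (I.cycleSubmodule (s + 1)) 2) :=
    ExtModule.subsingleton_cycleSubmodule_add N hI hX 1 (fun i hi ↦ hlow i (by lia)) 2 (by lia)
  obtain ⟨f, hf⟩ := hx.exists_injective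
  have hinj : Injective (ModuleCat.of R (I.cycleSubmodule (s + 1))) :=
    ExtModule.injective_of_residueField _
      (fun N _ _ _ ↦ ExtModule.finite_cycleSubmodule N hI (fun j hj ↦ hM N j hj) _ 1 le_rfl) hW2
      -- Ext^1(k, Z_{s+1}) sits between Ext^1(R/(x), Z_{s+1}) = 0 and an Ext^2 that vanishes.
      (ExtModule.subsingleton_left' _ f.exact_map_mkQ_range hf (Submodule.mkQ_surjective _)
        hW1 (hW2 _))
  obtain ⟨m, hm, hres⟩ := hI.exists_shorter hb hh (by lia) hinj
  exact hmin m (by lia) hres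

end

theorem corollary3p2 (R : Type u) [CommRing R] [IsNoetherianRing R] [IsLocalRing R]
    (M : Type u) [AddCommGroup M] [Module R M] [Nontrivial M]
    (hM : IsExtFinite R M) (hqid : quasiInjectiveDimension R M < ⊤)
    (x : List R) (hx : IsMaximalRegularSequence R x) :
    (quasiInjectiveDimension R M = 0 ↔
      ∀ i : ℕ, 0 < i → Subsingleton
        (Abelian.Ext.{u} (ModuleCat.of R (R ⧸ Ideal.ofList x)) (ModuleCat.of R M) i)) ∧
    (quasiInjectiveDimension R M ≠ 0 →
      quasiInjectiveDimension R M =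
        sSup ((fun i : ℕ => (i : WithBot ℕ∞)) '' {i : ℕ | Nontrivial
          (Abelian.Ext.{u} (ModuleCat.of R (R ⧸ Ideal.ofList x)) (ModuleCat.of R M) i)})) := by
  obtain ⟨n, hn, hvan, hne⟩ := exists_quasiInjectiveDimension_eq_ext hM hqid hx
  have h0 : (n : WithBot ℕ∞) = 0 ↔ n = 0 := by exact_mod_cast Iff.rfl
  rw [hn, Ne, h0]
  refine ⟨⟨?_, fun h ↦ ?_⟩, fun h ↦ ?_⟩
  · rintro rfl
    exact hvan
  · by_contra hn0
    have := hne hn0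
    exact not_subsingleton _ (h n (Nat.pos_of_ne_zero hn0))
  · symm
    refine IsGreatest.csSup_eq ⟨⟨n, hne h, rfl⟩, ?_⟩
    rintro _ ⟨j, hj, rfl⟩
    have : j ≤ n := by
      by_contra! hlt
      exact not_subsingleton_iff_nontrivial.2 hj (hvan j hlt)
    change (j : WithBot ℕ∞) ≤ n
    exact_mod_cast this
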